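/- Let $d\ge 2$ be an even integer. Say that $\phi:\mathbb{R}^d\times\mathbb{R}^d\to\mathbb{R}$ satisfies the derivative condition if there is a nonempty open set $\mathcal U\subset\mathbb{R}^d$ such that for every pair of distinct points $a,b\in\mathcal U$ there are open sets $A,B\subset\mathcal U$ with $a\in A$, $b\in B$, such that $\phi$ is $C^1$ on $A\times B$ and $$\frac{\partial\phi(x,y)}{\partial y_i}\neq 0\qquad\text{for all }(x,y)\in A\times B\text{ and all }i\in\{1,\dots,d\}.$$ Let $T$ be a finite tree (a connected acyclic graph) with a designated root $0$, and orient every edge away from the root, writing $\tau\to\sigma$ if $\tau$ is the parent of $\sigma$. For $X\subset\mathbb{R}^d$ and $y\in X$, the pinned $(\phi,T)$ distance set of $X$ with pin $y$ is $$\Delta^{\phi,T}_y(X)=\Big\{\big(\phi(x^\tau,x^\sigma)\big)_{\tau\to\sigma}\;:\;\{x^\tau\}_{\tau\in T}\text{ are distinct points of }X,\ x^0=y\Big\}\subset\mathbb{R}^{n-1},$$ where $n$ is the number of vertices of $T$. A Cantor set is a nonempty compact, totally disconnected, perfect set. Then, for every finite rooted tree $T$ and every $\phi:\mathbb{R}^d\times\mathbb{R}^d\to\mathbb{R}$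 satisfying the derivative condition, there exists a Cantor set $C\subset\mathbb{R}^d$ such that $\dim_{\rm H}(C)=\frac d2$ and $\Delta^{\phi,T}_y(C)$ has nonempty interior in $\mathbb{R}^{n-1}$ for some $y\in C$. -/

import Mathlib

/-- A Cantor set: a nonempty compact, totally disconnected, perfect set. -/
def IsCantorSet {X : Type*} [TopologicalSpace X] (C : Set X) : Prop :=
  C.Nonempty ∧ IsCompact C ∧ IsTotallyDisconnected C ∧ Perfect C

/-- The derivative condition for `φ : ℝ^d × ℝ^d → ℝ`: there is a nonempty open set `U` such that
any two distinct points `a, b` of `U` have open neighbourhoods `A, B ⊆ U` for which `φ` is `C¹`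
on `A × B` and all the partial derivatives `∂φ(x, y)/∂y_i` are nonzero on `A × B`. -/
def DerivativeCondition {d : ℕ}
    (φ : EuclideanSpace ℝ (Fin d) → EuclideanSpace ℝ (Fin d) → ℝ) : Prop :=
  ∃ U : Set (EuclideanSpace ℝ (Fin d)), IsOpen U ∧ U.Nonempty ∧
    ∀ a ∈ U, ∀ b ∈ U, a ≠ b →
      ∃ A B : Set (EuclideanSpace ℝ (Fin d)),
        IsOpen A ∧ IsOpen B ∧ A ⊆ U ∧ B ⊆ U ∧ a ∈ A ∧ b ∈ B ∧
        ContDiffOn ℝ 1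
          (fun p : EuclideanSpace ℝ (Fin d) × EuclideanSpace ℝ (Fin d) => φ p.1 p.2) (A ×ˢ B) ∧
        ∀ x ∈ A, ∀ y ∈ B, ∀ i : Fin d,
          lineDeriv ℝ (φ x) y (EuclideanSpace.single i (1 : ℝ)) ≠ 0

/-- The edges of a graph `T` with root `r`, oriented away from the root: pairs (parent, child),
the child being one step further from the root than the parent. In a tree every edge has exactly
one such orientation. -/
abbrev RootedEdge {V : Type*} (T : SimpleGraph V) (r : V) : Type _ :=
  {e : V × V // T.Adj e.1 e.2 ∧ T.dist r e.2 = T.dist r e.1 + 1}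

/-- The pinned `(φ, T)` distance set of `X` with pin `y`, for a tree `T` with root `r`: all vectors
`(φ(x^τ, x^σ))`, indexed by the edges from a parent `τ` to a child `σ`, where the `x^τ` are
distinct points of `X` and the root is placed at `y`. -/
def pinnedTreeDistanceSet {E V : Type*} (φ : E → E → ℝ) (T : SimpleGraph V) (r : V)
    (X : Set E) (y : E) : Set (RootedEdge T r → ℝ) :=
  {l | ∃ x : V → E, Function.Injective x ∧ (∀ τ, x τ ∈ X) ∧ x r = y ∧
    ∀ e : RootedEdge T r, l e = φ (x e.1.1) (x e.1.2)}

open Set Filter Topology MeasureTheory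
open scoped Pointwise ENNReal NNReal

/-! Write `d = m + m`. On the line there are two Cantor sets with the same stage lengths: a sparse
one, keeping 3 subintervals per stage, and a dense one, keeping `2 * 2 ^ n + 1` subintervals of
relative length `1 / (3 * 2 ^ n + 1)`. Both are null, yet a function of two variables with all
difference quotients in `[2/3, 4/3]` maps their product onto a full interval
(`NearlySum.Icc_subset_image`): each gap of one factor is bridged by the variation in the other.

The product `boxCantor m` of `m` sparse and `m` dense sets has dimension `m = d / 2`. Its stages
need at most `3 ^ (m * n)` times `cellLength n ^ (-m)` cubes, and the first factor is negligible
because the lengths decay faster than any geometric sequence. Conversely, adding sparse and dense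
coordinates in pairs covers a cube in dimension `m`.

Near distinct points `a`, `b`, the nonzero partials of `φ` in its second variable are nearly
constant. Rescaling each coordinate by the inverse of its partial places a small copy of the box at
`b` whose image under `φ x` contains one fixed interval for every `x` close to `a`
(`exists_piece_image_contains`).

Put such a piece at each of finitely many distinct points indexed by the tree. Sizes are chosen from
the leaves towards the root, so that a parent's piece fits where its children's intervals are valid;
equations are then solved from the root outwards (`exists_forall_edge_eq`). Hence a whole box of
edge values is attained with the root fixed. -/

/-! ### Cantor sets on the line. -/

/-- The common length of the intervals of the `n`-th stage of the Cantor sets below. -/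
noncomputable def cellLength : ℕ → ℝ
  | 0 => 1
  | n + 1 => cellLength n / (3 * 2 ^ n + 1)

/-- The left endpoints of the intervals of the `n`-th stage: each interval of the `n`-th stage is
replaced by `m n + 1` evenly spaced ones, the outer two sharing an endpoint with it. -/
noncomputable def leftEnds (m : ℕ → ℕ) : ℕ → Finset ℝ
  | 0 => {0}
  | n + 1 => leftEnds m n + (Finset.range (m n + 1)).image
      (fun j : ℕ => (j : ℝ) * ((cellLength n - cellLength (n + 1)) / m n))

/-- The Cantor set in the line whose `n`-th stage consists of the intervals of length
`cellLength n` with left endpoints `leftEnds m n`. -/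
def lineCantor (m : ℕ → ℕ) : Set ℝ :=
  {y | ∀ n, ∃ x ∈ leftEnds m n, x ≤ y ∧ y ≤ x + cellLength n}

theorem cellLength_pos (n : ℕ) : 0 < cellLength n := by
  induction n with
  | zero => simp [cellLength]
  | succ n ih => rw [cellLength]; positivity

theorem cellLength_succ_mul (n : ℕ) : cellLength (n + 1) * (3 * 2 ^ n + 1) = cellLength n := by
  rw [cellLength]; field_simp

theorem four_mul_cellLength_succ_le (n : ℕ) : 4 * cellLength (n + 1) ≤ cellLength n := by
  have h1 : (1 : ℝ) ≤ 2 ^ n := one_le_pow₀ (by norm_num)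
  have := cellLength_pos (n + 1)
  rw [← cellLength_succ_mul n]
  nlinarith

theorem cellLength_le_quarter_pow (n : ℕ) : cellLength n ≤ (1 / 4) ^ n := by
  induction n with
  | zero => simp [cellLength]
  | succ n ih =>
    have := four_mul_cellLength_succ_le n
    rw [pow_succ]; linarith

theorem tendsto_cellLength : Tendsto cellLength atTop (𝓝 0) :=
  squeeze_zero (fun n => (cellLength_pos n).le) cellLength_le_quarter_pow
    (tendsto_pow_atTop_nhds_zero_of_lt_one (by norm_num) (by norm_num))

theorem mem_leftEnds_succ {m : ℕ → ℕ} {n : ℕ} {y : ℝ} :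
    y ∈ leftEnds m (n + 1) ↔ ∃ x ∈ leftEnds m n, ∃ j ≤ m n,
      x + (j : ℝ) * ((cellLength n - cellLength (n + 1)) / m n) = y := by
  simp only [leftEnds, Finset.mem_add, Finset.mem_image, Finset.mem_range, Nat.lt_succ_iff]
  constructor
  · rintro ⟨x, hx, _, ⟨j, hj, rfl⟩, rfl⟩
    exact ⟨x, hx, j, hj, rfl⟩
  · rintro ⟨x, hx, j, hj, rfl⟩
    exact ⟨x, hx, _, ⟨j, hj, rfl⟩, rfl⟩

theorem card_leftEnds_le (m : ℕ → ℕ) (n : ℕ) :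
    (leftEnds m n).card ≤ ∏ i ∈ Finset.range n, (m i + 1) := by
  induction n with
  | zero => simp [leftEnds]
  | succ n ih =>
    rw [leftEnds, Finset.prod_range_succ]
    refine Finset.card_add_le.trans (Nat.mul_le_mul ih ?_)
    exact Finset.card_image_le.trans (by simp)

section

variable {m : ℕ → ℕ}

theorem exists_leftEnds_coarser {n k : ℕ} (h : k ≤ n) : ∀ x ∈ leftEnds m n,
    ∃ z ∈ leftEnds m k, z ≤ x ∧ x + cellLength n ≤ z + cellLength k := by
  induction n, h using Nat.le_induction with
  | base => exact fun x hx => ⟨x, hx, le_rfl, le_rfl⟩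
  | succ n _ ih =>
    intro x hx
    obtain ⟨y, hy, j, hj, rfl⟩ := mem_leftEnds_succ.1 hx
    obtain ⟨z, hz, h1, h2⟩ := ih y hy
    have hd : 0 ≤ cellLength n - cellLength (n + 1) := by
      linarith [four_mul_cellLength_succ_le n, cellLength_pos (n + 1)]
    have hj' : (j : ℝ) * ((cellLength n - cellLength (n + 1)) / m n)
        ≤ cellLength n - cellLength (n + 1) := by
      -- If `m n = 0`, division by zero gives spacing `0`, and the bound still holds.
      rcases Nat.eq_zero_or_pos (m n) with h0 | h0
      · simpa [h0] using hd
      · have : (j : ℝ) ≤ m n := by exact_mod_cast hj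
        have h0' : (0 : ℝ) < m n := by exact_mod_cast h0
        rw [mul_div_assoc', div_le_iff₀ h0', mul_comm]
        exact mul_le_mul_of_nonneg_left this hd
    have hj0 : 0 ≤ (j : ℝ) * ((cellLength n - cellLength (n + 1)) / m n) := by positivity
    exact ⟨z, hz, by linarith, by linarith⟩

theorem leftEnds_subset_of_le {n k : ℕ} (h : n ≤ k) : leftEnds m n ⊆ leftEnds m k := by
  induction k, h using Nat.le_induction with
  | base => exact Finset.Subset.refl _
  | succ k _ ih =>
    exact fun x hx => mem_leftEnds_succ.2 ⟨x, ih hx, 0, Nat.zero_le _, by simp⟩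

theorem leftEnds_subset_lineCantor (n : ℕ) : ↑(leftEnds m n) ⊆ lineCantor m := by
  intro x hx k
  rcases le_total n k with h | h
  · exact ⟨x, leftEnds_subset_of_le h hx, le_rfl, by linarith [cellLength_pos k]⟩
  · obtain ⟨z, hz, h1, h2⟩ := exists_leftEnds_coarser h x hx
    exact ⟨z, hz, h1, by linarith [cellLength_pos n]⟩

theorem add_sub_mem_leftEnds (hm : ∀ n, m n ≠ 0) {n k : ℕ} (h : n ≤ k) {x : ℝ}
    (hx : x ∈ leftEnds m n) : x + cellLength n - cellLength k ∈ leftEnds m k := by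
  induction k, h using Nat.le_induction with
  | base => simpa using hx
  | succ k _ ih =>
    refine mem_leftEnds_succ.2 ⟨_, ih, m k, le_rfl, ?_⟩
    have : (m k : ℝ) ≠ 0 := by exact_mod_cast hm k
    field_simp
    ring

theorem add_cellLength_mem_lineCantor (hm : ∀ n, m n ≠ 0) {n : ℕ} {x : ℝ}
    (hx : x ∈ leftEnds m n) : x + cellLength n ∈ lineCantor m := by
  intro k
  rcases le_total n k with h | h
  · exact ⟨_, add_sub_mem_leftEnds hm h hx, by linarith [cellLength_pos k], by linarith⟩
  · obtain ⟨z, hz, h1, h2⟩ := exists_leftEnds_coarser h x hx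
    exact ⟨z, hz, by linarith [cellLength_pos n], h2⟩

theorem zero_mem_lineCantor : (0 : ℝ) ∈ lineCantor m :=
  leftEnds_subset_lineCantor 0 (by simp [leftEnds])

theorem lineCantor_subset_Icc : lineCantor m ⊆ Icc 0 1 := by
  intro y hy
  obtain ⟨x, hx, h1, h2⟩ := hy 0
  simp only [leftEnds, Finset.mem_singleton, cellLength] at hx h2
  subst hx
  exact ⟨h1, by linarith⟩

theorem lineCantor_eq : lineCantor m =
    ⋂ n, ⋃ x ∈ leftEnds m n, Icc x (x + cellLength n) := by
  ext y
  simp only [lineCantor, mem_ofPred_eq, mem_iInter, mem_iUnion, exists_prop, mem_Icc]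

theorem isCompact_lineCantor : IsCompact (lineCantor m) := by
  refine isCompact_Icc.of_isClosed_subset ?_ lineCantor_subset_Icc
  rw [lineCantor_eq]
  exact isClosed_iInter fun n => isClosed_biUnion_finset fun x _ => isClosed_Icc

theorem preperfect_lineCantor (hm : ∀ n, m n ≠ 0) : Preperfect (lineCantor m) := by
  rw [preperfect_iff_nhds]
  intro y hy U hU
  obtain ⟨ε, hε, hεU⟩ := Metric.mem_nhds_iff.1 hU
  obtain ⟨n, hn⟩ := (tendsto_cellLength.eventually_lt_const hε).exists
  obtain ⟨x, hx, h1, h2⟩ := hy n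
  have hpos := cellLength_pos n
  -- Both endpoints of the cell containing `y` lie in the set, and at least one of them differs from
  -- `y`.
  by_cases hxy : x = y
  · refine ⟨x + cellLength n, ⟨hεU ?_, add_cellLength_mem_lineCantor hm hx⟩, by linarith⟩
    rw [Metric.mem_ball, Real.dist_eq, abs_lt]; constructor <;> linarith
  · refine ⟨x, ⟨hεU ?_, leftEnds_subset_lineCantor n hx⟩, hxy⟩
    rw [Metric.mem_ball, Real.dist_eq, abs_lt]; constructor <;> linarith

/-- The hypothesis makes each stage shrink the bound on total length by a factor of at most `3/4`.
-/
theorem volume_lineCantor (hm : ∀ n, 4 * (m n + 1) ≤ 3 * (3 * 2 ^ n + 1)) :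
    volume (lineCantor m) = 0 := by
  have hcard : ∀ n, ((leftEnds m n).card : ℝ) * cellLength n ≤ (3 / 4) ^ n := by
    intro n
    have h : (∏ i ∈ Finset.range n, ((m i : ℝ) + 1)) * cellLength n ≤ (3 / 4) ^ n := by
      induction n with
      | zero => simp [cellLength]
      | succ n ih =>
        rw [Finset.prod_range_succ, pow_succ, cellLength]
        have h4 : 4 * ((m n : ℝ) + 1) ≤ 3 * (3 * 2 ^ n + 1) := by exact_mod_cast hm n
        have h5 : ((m n : ℝ) + 1) / (3 * 2 ^ n + 1) ≤ 3 / 4 := by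
          rw [div_le_div_iff₀ (by positivity) (by norm_num)]; linarith
        calc _ = ((∏ i ∈ Finset.range n, ((m i : ℝ) + 1)) * cellLength n) *
              (((m n : ℝ) + 1) / (3 * 2 ^ n + 1)) := by ring
          _ ≤ _ := mul_le_mul ih h5 (by positivity) (by positivity)
    refine le_trans (mul_le_mul_of_nonneg_right ?_ (cellLength_pos n).le) h
    exact_mod_cast card_leftEnds_le m n
  have hle : ∀ n, volume (lineCantor m) ≤ ENNReal.ofReal ((3 / 4) ^ n) := by
    intro n
    calc volume (lineCantor m) ≤ volume (⋃ x ∈ leftEnds m n, Icc x (x + cellLength n)) := by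
          rw [lineCantor_eq]; exact measure_mono (iInter_subset _ n)
      _ ≤ ∑ x ∈ leftEnds m n, volume (Icc x (x + cellLength n)) := measure_biUnion_finset_le _ _
      _ = ENNReal.ofReal ((leftEnds m n).card * cellLength n) := by
          simp [ENNReal.ofReal_mul]
      _ ≤ _ := ENNReal.ofReal_le_ofReal (hcard n)
  have hlim : Tendsto (fun n : ℕ => ENNReal.ofReal ((3 / 4 : ℝ) ^ n)) atTop (𝓝 0) := by
    rw [← ENNReal.ofReal_zero]
    exact ENNReal.tendsto_ofReal
      (tendsto_pow_atTop_nhds_zero_of_lt_one (by norm_num) (by norm_num))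
  exact le_antisymm (ge_of_tendsto' hlim hle) bot_le

end

/-! ### Intervals in images of sparse times dense sets. -/

/-- Consecutively overlapping intervals `[p j, q j]` cover `[p 0, q N]`. -/
theorem exists_mem_Icc_of_overlap (p q : ℕ → ℝ) {t : ℝ} (N : ℕ) (h0 : p 0 ≤ t) (hN : t ≤ q N)
    (h : ∀ j < N, p (j + 1) ≤ q j) : ∃ j ≤ N, p j ≤ t ∧ t ≤ q j := by
  induction N with
  | zero => exact ⟨0, le_rfl, h0, hN⟩
  | succ N ih =>
    by_cases hp : p (N + 1) ≤ t
    · exact ⟨N + 1, le_rfl, hp, hN⟩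
    · obtain ⟨j, hj, hj'⟩ := ih ((not_le.1 hp).le.trans (h N (Nat.lt_succ_self N)))
        fun j hj => h j (hj.trans (Nat.lt_succ_self N))
      exact ⟨j, hj.trans (Nat.le_succ N), hj'⟩

/-- The number of steps per stage of a sparse Cantor set. -/
def sparseSteps : ℕ → ℕ := fun _ => 2

/-- The number of steps per stage of a dense Cantor set. -/
def denseSteps : ℕ → ℕ := fun n => 2 * 2 ^ n

/-- A real function of two variables on the unit square whose difference quotients in each
variable lie between `2/3` and `4/3`. -/
structure NearlySum (f : ℝ → ℝ → ℝ) : Prop where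
  left_lower : ∀ u ∈ Icc (0 : ℝ) 1, ∀ u' ∈ Icc (0 : ℝ) 1, ∀ v ∈ Icc (0 : ℝ) 1, u ≤ u' →
    2 / 3 * (u' - u) ≤ f u' v - f u v
  left_upper : ∀ u ∈ Icc (0 : ℝ) 1, ∀ u' ∈ Icc (0 : ℝ) 1, ∀ v ∈ Icc (0 : ℝ) 1, u ≤ u' →
    f u' v - f u v ≤ 4 / 3 * (u' - u)
  right_lower : ∀ u ∈ Icc (0 : ℝ) 1, ∀ v ∈ Icc (0 : ℝ) 1, ∀ v' ∈ Icc (0 : ℝ) 1, v ≤ v' →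
    2 / 3 * (v' - v) ≤ f u v' - f u v
  right_upper : ∀ u ∈ Icc (0 : ℝ) 1, ∀ v ∈ Icc (0 : ℝ) 1, ∀ v' ∈ Icc (0 : ℝ) 1, v ≤ v' →
    f u v' - f u v ≤ 4 / 3 * (v' - v)

/-- Let `r`, `s` be consecutive lengths. The sparse coordinate is refined first, while the dense one
still spans `r`: crossing a sparse gap costs at most `4/3 * (r - 3 * s) / 2`, less than the gain
`2/3 * r`. Then the dense coordinate is refined: its spacing is `3/2 * s`, so a gap costs at most
`4/3 * (s / 2)`, exactly repaid by the gain `2/3 * s` across the sparse cell. -/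
theorem NearlySum.exists_cell {f : ℝ → ℝ → ℝ} (hf : NearlySum f) {t : ℝ}
    (h0 : f 0 0 ≤ t) (h1 : t ≤ f 1 1) (n : ℕ) :
    ∃ x ∈ leftEnds sparseSteps n, ∃ y ∈ leftEnds denseSteps n,
      f x y ≤ t ∧ t ≤ f (x + cellLength n) (y + cellLength n) := by
  have unit : ∀ {m : ℕ → ℕ} {k : ℕ} {x : ℝ}, x ∈ leftEnds m k → 0 ≤ x ∧ x + cellLength k ≤ 1 := by
    intro m k x hx
    obtain ⟨z, hz, h1, h2⟩ := exists_leftEnds_coarser (Nat.zero_le k) x hx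
    simp only [leftEnds, Finset.mem_singleton, cellLength] at hz h2
    subst hz
    exact ⟨h1, by linarith⟩
  induction n with
  | zero => exact ⟨0, by simp [leftEnds], 0, by simp [leftEnds], h0, by simpa [cellLength] using h1⟩
  | succ n ih =>
    obtain ⟨x, hx, y, hy, hl, hr⟩ := ih
    have hr0 := cellLength_pos (n + 1)
    have hr4 := four_mul_cellLength_succ_le n
    have hrm := cellLength_succ_mul n
    set r := cellLength n with hrdef
    set s := cellLength (n + 1) with hsdef
    have hxu := unit hx
    have hyu := unit hy
    have hs_g : (r - s) / (sparseSteps n : ℕ) = (r - s) / 2 := by simp [sparseSteps]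
    have hs_h : (r - s) / (denseSteps n : ℕ) = 3 / 2 * s := by
      have : (2 : ℝ) ^ n ≠ 0 := by positivity
      simp only [denseSteps, Nat.cast_mul, Nat.cast_pow, Nat.cast_ofNat]
      rw [← hrm]; field_simp; ring
    obtain ⟨i, hi, hil, hir⟩ := exists_mem_Icc_of_overlap
      (fun j : ℕ => f (x + j * ((r - s) / (sparseSteps n : ℕ))) y)
      (fun j : ℕ => f (x + j * ((r - s) / (sparseSteps n : ℕ)) + s) (y + r)) (t := t) 2
      (by simpa using hl)
      (by
        have : x + ((2 : ℕ) : ℝ) * ((r - s) / (sparseSteps n : ℕ)) + s = x + r := by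
          rw [hs_g]; push_cast; ring
        rw [this]; exact hr)
      (by
        intro j hj
        have hj1 : (j : ℝ) ≤ 1 := by exact_mod_cast Nat.lt_succ_iff.1 hj
        have hj0 : (0 : ℝ) ≤ j := Nat.cast_nonneg j
        simp only [hs_g]
        set w := x + (j : ℝ) * ((r - s) / 2) with hw
        have hww : x + ((j + 1 : ℕ) : ℝ) * ((r - s) / 2) = w + (r - s) / 2 := by
          rw [hw]; push_cast; ring
        have hw0 : 0 ≤ (j : ℝ) * ((r - s) / 2) := mul_nonneg hj0 (by linarith)
        have hw1 : (j : ℝ) * ((r - s) / 2) ≤ (r - s) / 2 :=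
          mul_le_of_le_one_left (by linarith) hj1
        rw [hww]
        have e1 := hf.left_upper (w + s) ⟨by linarith, by linarith⟩ (w + (r - s) / 2)
          ⟨by linarith, by linarith⟩ y ⟨by linarith, by linarith⟩ (by linarith)
        have e2 := hf.right_lower (w + s) ⟨by linarith, by linarith⟩ y ⟨by linarith, by linarith⟩
          (y + r) ⟨by linarith, by linarith⟩ (by linarith)
        linarith)
    have hx' : x + i * ((r - s) / (sparseSteps n : ℕ)) ∈ leftEnds sparseSteps (n + 1) :=
      mem_leftEnds_succ.2 ⟨x, hx, i, hi, rfl⟩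
    set x' := x + i * ((r - s) / (sparseSteps n : ℕ)) with hx'def
    have hxu' := unit hx'
    have hmul : ∀ j : ℕ, j ≤ denseSteps n → (j : ℝ) * (3 / 2 * s) ≤ r - s := by
      intro j hj
      have : (j : ℝ) ≤ 2 * 2 ^ n := by exact_mod_cast hj
      nlinarith
    obtain ⟨k, hk, hkl, hkr⟩ := exists_mem_Icc_of_overlap
      (fun j : ℕ => f x' (y + j * ((r - s) / (denseSteps n : ℕ))))
      (fun j : ℕ => f (x' + s) (y + j * ((r - s) / (denseSteps n : ℕ)) + s)) (t := t) (denseSteps n)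
      (by simpa using hil)
      (by
        have : y + (denseSteps n : ℝ) * ((r - s) / (denseSteps n : ℕ)) + s = y + r := by
          have : (denseSteps n : ℝ) ≠ 0 := by simp [denseSteps]
          field_simp; ring
        rw [this]; exact hir)
      (by
        intro j hj
        simp only [hs_h]
        have hj' := hmul (j + 1) hj
        have hj0 : (0 : ℝ) ≤ (j : ℝ) * (3 / 2 * s) := by positivity
        push_cast at hj' ⊢
        set w := y + (j : ℝ) * (3 / 2 * s) with hw
        have hww : y + ((j : ℝ) + 1) * (3 / 2 * s) = w + 3 / 2 * s := by rw [hw]; ring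
        rw [hww]
        have hjw : w + 3 / 2 * s ≤ y + (r - s) := by rw [← hww]; linarith
        have e1 := hf.right_upper x' ⟨by linarith, by linarith⟩ (w + s) ⟨by linarith, by linarith⟩
          (w + 3 / 2 * s) ⟨by linarith, by linarith⟩ (by linarith)
        have e2 := hf.left_lower x' ⟨by linarith, by linarith⟩ (x' + s) ⟨by linarith, by linarith⟩
          (w + s) ⟨by linarith, by linarith⟩ (by linarith)
        linarith)
    exact ⟨x', hx', _, mem_leftEnds_succ.2 ⟨y, hy, k, hk, rfl⟩, hkl, hkr⟩

theorem NearlySum.Icc_subset_image {f : ℝ → ℝ → ℝ} (hf : NearlySum f)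
    (hcont : ContinuousOn (fun p : ℝ × ℝ => f p.1 p.2) (Icc 0 1 ×ˢ Icc 0 1)) :
    Icc (f 0 0) (f 1 1) ⊆
      (fun p : ℝ × ℝ => f p.1 p.2) '' (lineCantor sparseSteps ×ˢ lineCantor denseSteps) := by
  intro t ht
  have hcpt : IsCompact ((fun p : ℝ × ℝ => f p.1 p.2) ''
      (lineCantor sparseSteps ×ˢ lineCantor denseSteps)) :=
    (isCompact_lineCantor.prod isCompact_lineCantor).image_of_continuousOn
      (hcont.mono (prod_mono lineCantor_subset_Icc lineCantor_subset_Icc))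
  choose x hx y hy hl hr using hf.exists_cell ht.1 ht.2
  have hsd : ∀ n, sparseSteps n ≠ 0 := fun n => by simp [sparseSteps]
  have hdd : ∀ n, denseSteps n ≠ 0 := fun n => by simp [denseSteps]
  have hlim : Tendsto (fun n => f (x n) (y n)) atTop (𝓝 t) := by
    -- Across a cell `f` varies by at most `4/3` of the length in each variable, hence `8/3` in
    -- total.
    have hz : Tendsto (fun n => t - 8 / 3 * cellLength n) atTop (𝓝 t) := by
      simpa using tendsto_const_nhds.sub (tendsto_cellLength.const_mul (8 / 3))
    refine tendsto_of_tendsto_of_tendsto_of_le_of_le hz tendsto_const_nhds (fun n => ?_) hl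
    have hpos := cellLength_pos n
    have a1 := lineCantor_subset_Icc (leftEnds_subset_lineCantor n (hx n))
    have a2 := lineCantor_subset_Icc (leftEnds_subset_lineCantor n (hy n))
    have a3 := lineCantor_subset_Icc (add_cellLength_mem_lineCantor hsd (hx n))
    have a4 := lineCantor_subset_Icc (add_cellLength_mem_lineCantor hdd (hy n))
    have e1 := hf.left_upper _ a1 _ a3 _ a2 (by linarith)
    have e2 := hf.right_upper _ a3 _ a2 _ a4 (by linarith)
    have := hr n
    show t - 8 / 3 * cellLength n ≤ f (x n) (y n)
    linarith
  exact hcpt.isClosed.mem_of_tendsto hlim (Eventually.of_forall fun n =>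
    ⟨(x n, y n), ⟨leftEnds_subset_lineCantor n (hx n), leftEnds_subset_lineCantor n (hy n)⟩, rfl⟩)

/-! ### The product set and its dimension. -/

/-- The number of steps for each coordinate of `boxCantor`. -/
def coordSteps (m : ℕ) : Fin (m + m) → ℕ → ℕ :=
  Fin.addCases (fun _ => sparseSteps) (fun _ => denseSteps)

theorem coordSteps_castAdd {m : ℕ} (i : Fin m) :
    coordSteps m (Fin.castAdd m i) = sparseSteps := Fin.addCases_left i

theorem coordSteps_natAdd {m : ℕ} (i : Fin m) :
    coordSteps m (Fin.natAdd m i) = denseSteps := Fin.addCases_right i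

/-- A product of `m` sparse and `m` dense Cantor sets. -/
def boxCantor (m : ℕ) : Set (Fin (m + m) → ℝ) :=
  univ.pi fun i => lineCantor (coordSteps m i)

theorem coordSteps_ne_zero (m : ℕ) (i : Fin (m + m)) (n : ℕ) : coordSteps m i n ≠ 0 := by
  refine Fin.addCases (fun i => ?_) (fun i => ?_) i
  · simp [coordSteps_castAdd, sparseSteps]
  · simp only [coordSteps_natAdd, denseSteps]; positivity

theorem volume_lineCantor_coordSteps (m : ℕ) (i : Fin (m + m)) :
    volume (lineCantor (coordSteps m i)) = 0 := by
  refine volume_lineCantor fun n => ?_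
  have : 1 ≤ 2 ^ n := Nat.one_le_two_pow
  refine Fin.addCases (fun i => ?_) (fun i => ?_) i
  · simp only [coordSteps_castAdd, sparseSteps]; omega
  · simp only [coordSteps_natAdd, denseSteps]; omega

theorem isCompact_boxCantor (m : ℕ) : IsCompact (boxCantor m) :=
  isCompact_univ_pi fun _ => isCompact_lineCantor

theorem zero_mem_boxCantor (m : ℕ) : (0 : Fin (m + m) → ℝ) ∈ boxCantor m :=
  fun _ _ => zero_mem_lineCantor

theorem preperfect_boxCantor {m : ℕ} (hm : 0 < m) : Preperfect (boxCantor m) := by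
  rw [preperfect_iff_nhds]
  intro w hw U hU
  let i : Fin (m + m) := ⟨0, by omega⟩
  have hcont : Continuous fun a : ℝ => Function.update w i a :=
    continuous_const.update i continuous_id
  have hV : (fun a : ℝ => Function.update w i a) ⁻¹' U ∈ 𝓝 (w i) :=
    hcont.continuousAt (by simpa using hU)
  obtain ⟨a, ⟨haU, ha⟩, hne⟩ := preperfect_iff_nhds.1
    (preperfect_lineCantor (coordSteps_ne_zero m i)) (w i) (hw i trivial) _ hV
  refine ⟨Function.update w i a, ⟨haU, fun j _ => ?_⟩, fun h => hne ?_⟩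
  · rcases eq_or_ne j i with rfl | hj
    · simpa using ha
    · simpa [hj] using hw j trivial
  · simpa using congrFun h i

/-- Each sparse factor has at most `3 ^ n` cells; each dense factor at most the reciprocal length,
since `2 * 2 ^ i + 1 ≤ 3 * 2 ^ i + 1`. -/
theorem prod_card_leftEnds_le (m n : ℕ) :
    ((∏ i, (leftEnds (coordSteps m i) n).card : ℕ) : ℝ) ≤ (3 ^ m) ^ n * (cellLength n ^ m)⁻¹ := by
  have hs : ((leftEnds sparseSteps n).card : ℝ) ≤ 3 ^ n := by
    have := card_leftEnds_le sparseSteps n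
    simp only [sparseSteps, Finset.prod_const, Finset.card_range] at this
    exact_mod_cast this
  have hd : ((leftEnds denseSteps n).card : ℝ) ≤ (cellLength n)⁻¹ := by
    have h1 : ((leftEnds denseSteps n).card : ℝ) ≤ ∏ i ∈ Finset.range n, ((denseSteps i : ℝ) + 1) :=
      by exact_mod_cast card_leftEnds_le denseSteps n
    refine h1.trans ?_
    clear h1 hs
    induction n with
    | zero => simp [cellLength]
    | succ n ih =>
      rw [Finset.prod_range_succ, cellLength, inv_div, div_eq_inv_mul]
      refine mul_le_mul ih ?_ (by positivity) (inv_nonneg.2 (cellLength_pos n).le)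
      · have : (0 : ℝ) < 2 ^ n := by positivity
        simp only [denseSteps]; push_cast; linarith
  rw [Fin.prod_univ_add]
  simp only [coordSteps_castAdd, coordSteps_natAdd, Finset.prod_const,
    Finset.card_univ, Fintype.card_fin, Nat.cast_mul, Nat.cast_pow]
  rw [← pow_mul, mul_comm m n, pow_mul, ← inv_pow]
  gcongr

/-- The ratio of consecutive terms is `a / (3 * 2 ^ n + 1) ^ δ`, which tends to `0`. This absorbs
the exponential count of sparse cells. -/
theorem tendsto_pow_mul_cellLength_rpow {a δ : ℝ} (ha : 0 < a) (hδ : 0 < δ) :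
    Tendsto (fun n => a ^ n * cellLength n ^ δ) atTop (𝓝 0) := by
  have hpos : ∀ n, 0 < a ^ n * cellLength n ^ δ := fun n =>
    mul_pos (pow_pos ha n) (Real.rpow_pos_of_pos (cellLength_pos n) δ)
  refine Summable.tendsto_atTop_zero (summable_of_ratio_test_tendsto_lt_one one_pos
    (Eventually.of_forall fun n => (hpos n).ne') (l := 0) ?_)
  have hN : Tendsto (fun n : ℕ => ((3 * 2 ^ n + 1 : ℝ)) ^ δ) atTop atTop := by
    refine (tendsto_rpow_atTop hδ).comp (tendsto_atTop_add_const_right _ _ ?_)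
    exact (tendsto_pow_atTop_atTop_of_one_lt (by norm_num)).const_mul_atTop (by norm_num)
  refine (hN.const_div_atTop a).congr fun n => ?_
  rw [Real.norm_of_nonneg (hpos _).le, Real.norm_of_nonneg (hpos _).le, cellLength,
    Real.div_rpow (cellLength_pos n).le (by positivity)]
  have h1 := (Real.rpow_pos_of_pos (cellLength_pos n) δ).ne'
  have h2 : ((3 * 2 ^ n + 1 : ℝ)) ^ δ ≠ 0 := (Real.rpow_pos_of_pos (by positivity) δ).ne'
  have h3 := (pow_pos ha n).ne'
  field_simp
  ring

theorem dimH_boxCantor_le (m : ℕ) : dimH (boxCantor m) ≤ m := by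
  refine ENNReal.le_of_forall_pos_le_add fun δ hδ _ => ?_
  have : (m : ℝ≥0∞) + δ = ((m + δ : ℝ≥0) : ℝ≥0∞) := by simp
  rw [this]
  refine dimH_le_of_hausdorffMeasure_ne_top ?_
  refine ne_top_of_le_ne_top (b := (0 : ℝ≥0∞)) ENNReal.zero_ne_top ?_
  let I : ℕ → Type := fun n => Fintype.piFinset fun i => leftEnds (coordSteps m i) n
  let cell : ∀ n, I n → Set (Fin (m + m) → ℝ) := fun n z =>
    univ.pi fun i => Icc (z.1 i) (z.1 i + cellLength n)
  have hdiam : ∀ n (z : I n), Metric.ediam (cell n z) ≤ ENNReal.ofReal (cellLength n) := by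
    intro n z
    refine Metric.ediam_pi_le_of_le fun i => ?_
    rw [Real.ediam_Icc]; simp
  have hr : Tendsto (fun n => ENNReal.ofReal (cellLength n)) atTop (𝓝 0) := by
    rw [← ENNReal.ofReal_zero]; exact ENNReal.tendsto_ofReal tendsto_cellLength
  have hcover : ∀ n, boxCantor m ⊆ ⋃ z, cell n z := by
    intro n w hw
    choose z hz h1 h2 using fun i => hw i trivial n
    exact mem_iUnion.2 ⟨⟨z, Fintype.mem_piFinset.2 hz⟩, fun i _ => ⟨h1 i, h2 i⟩⟩
  refine (Measure.hausdorffMeasure_le_liminf_sum _ (boxCantor m) _ hr cell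
    (Eventually.of_forall hdiam) (Eventually.of_forall hcover)).trans ?_
  have hbound : ∀ n, ∑ z, Metric.ediam (cell n z) ^ ((m + δ : ℝ≥0) : ℝ) ≤
      ENNReal.ofReal (((3 : ℝ) ^ m) ^ n * cellLength n ^ (δ : ℝ)) := by
    intro n
    have hpos := cellLength_pos n
    calc ∑ z, Metric.ediam (cell n z) ^ ((m + δ : ℝ≥0) : ℝ)
        ≤ ∑ _z : I n, ENNReal.ofReal (cellLength n ^ ((m + δ : ℝ≥0) : ℝ)) := by
          refine Finset.sum_le_sum fun z _ => ?_
          rw [← ENNReal.ofReal_rpow_of_pos hpos]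
          exact ENNReal.rpow_le_rpow (hdiam n z) (NNReal.coe_nonneg _)
      _ = ENNReal.ofReal (((∏ i, (leftEnds (coordSteps m i) n).card : ℕ) : ℝ) *
            cellLength n ^ ((m + δ : ℝ≥0) : ℝ)) := by
          rw [Finset.sum_const, Finset.card_univ, Fintype.card_coe, Fintype.card_piFinset,
            nsmul_eq_mul, ENNReal.ofReal_mul (Nat.cast_nonneg _), ENNReal.ofReal_natCast]
      _ ≤ _ := by
          refine ENNReal.ofReal_le_ofReal ?_
          refine (mul_le_mul_of_nonneg_right (prod_card_leftEnds_le m n)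
            (Real.rpow_nonneg hpos.le _)).trans_eq ?_
          push_cast
          rw [Real.rpow_add hpos, Real.rpow_natCast]
          have := (pow_pos hpos m).ne'
          field_simp
  have hlim : Tendsto (fun n => ∑ z, Metric.ediam (cell n z) ^ ((m + δ : ℝ≥0) : ℝ)) atTop (𝓝 0) := by
    refine tendsto_of_tendsto_of_tendsto_of_le_of_le tendsto_const_nhds ?_
      (fun _ => bot_le) hbound
    rw [← ENNReal.ofReal_zero]
    exact ENNReal.tendsto_ofReal
      (tendsto_pow_mul_cellLength_rpow (by positivity) (NNReal.coe_pos.2 hδ))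
  exact hlim.liminf_eq.le

/-! ### Diagonal affine copies of the product set. -/

/-- The affine map sending `w` to the point with coordinates `b i + k i * w i`. -/
noncomputable def diagMap {m : ℕ} (b : EuclideanSpace ℝ (Fin (m + m))) (k : Fin (m + m) → ℝ)
    (w : Fin (m + m) → ℝ) : EuclideanSpace ℝ (Fin (m + m)) :=
  WithLp.toLp 2 fun i => b i + k i * w i

@[simp] theorem diagMap_apply {m : ℕ} (b : EuclideanSpace ℝ (Fin (m + m))) (k w : Fin (m + m) → ℝ)
    (i : Fin (m + m)) : diagMap b k w i = b i + k i * w i := rfl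

theorem contDiff_diagMap {m : ℕ} (b : EuclideanSpace ℝ (Fin (m + m))) (k : Fin (m + m) → ℝ) :
    ContDiff ℝ 1 (diagMap b k) := by
  rw [contDiff_euclidean]
  intro i
  simp only [diagMap_apply]
  fun_prop

theorem diagMap_zero {m : ℕ} (b : EuclideanSpace ℝ (Fin (m + m))) (k : Fin (m + m) → ℝ) :
    diagMap b k 0 = b := by
  ext i; simp

theorem diagMap_injective {m : ℕ} (b : EuclideanSpace ℝ (Fin (m + m))) {k : Fin (m + m) → ℝ}
    (hk : ∀ i, k i ≠ 0) : Function.Injective (diagMap b k) := by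
  intro w w' h
  funext i
  have := congrArg (fun z : EuclideanSpace ℝ (Fin (m + m)) => z i) h
  simpa [hk i] using this

/-- A nondegenerate diagonal affine image of `boxCantor m` with base point `b`. -/
def IsPiece {m : ℕ} (b : EuclideanSpace ℝ (Fin (m + m))) (K : Set (EuclideanSpace ℝ (Fin (m + m)))) :
    Prop :=
  ∃ k : Fin (m + m) → ℝ, (∀ i, k i ≠ 0) ∧ K = diagMap b k '' boxCantor m

namespace IsPiece

variable {m : ℕ} {b : EuclideanSpace ℝ (Fin (m + m))} {K : Set (EuclideanSpace ℝ (Fin (m + m)))}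

theorem base_mem (h : IsPiece b K) : b ∈ K := by
  obtain ⟨k, -, rfl⟩ := h
  exact ⟨0, zero_mem_boxCantor m, diagMap_zero b k⟩

theorem isCompact (h : IsPiece b K) : IsCompact K := by
  obtain ⟨k, -, rfl⟩ := h
  exact (isCompact_boxCantor m).image (contDiff_diagMap b k).continuous

theorem preperfect (h : IsPiece b K) (hm : 0 < m) : Preperfect K := by
  obtain ⟨k, hk, rfl⟩ := h
  rintro _ ⟨w, hw, rfl⟩
  have := (preperfect_boxCantor hm w hw).map (contDiff_diagMap b k).continuous.continuousAt
    (diagMap_injective b hk)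
  rwa [map_principal] at this

theorem dimH_le (h : IsPiece b K) : dimH K ≤ m := by
  obtain ⟨k, -, rfl⟩ := h
  exact ((contDiff_diagMap b k).contDiffOn.dimH_image_le convex_univ (subset_univ _)).trans
    (dimH_boxCantor_le m)

theorem volume_coord (h : IsPiece b K) (i : Fin (m + m)) : volume ((fun z => z i) '' K) = 0 := by
  obtain ⟨k, -, rfl⟩ := h
  refine measure_mono_null (t := (fun a : ℝ => b i + k i * a) '' lineCantor (coordSteps m i)) ?_ ?_
  · rintro _ ⟨_, ⟨w, hw, rfl⟩, rfl⟩
    exact ⟨w i, hw i trivial, rfl⟩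
  · exact addHaar_image_eq_zero_of_differentiableOn_of_addHaar_eq_zero volume
      (by fun_prop) (volume_lineCantor_coordSteps m i)

end IsPiece

theorem nearlySum_add : NearlySum fun u v => u + v := by
  constructor <;> intros <;> linarith

/-- Pairing each sparse coordinate with a dense one, the sum map is `C¹` and its image contains `[0,
2] ^ m`; such a map cannot raise dimension. -/
theorem le_dimH_diagMap_one (m : ℕ) :
    (m : ℝ≥0∞) ≤ dimH (diagMap (m := m) 0 1 '' boxCantor m) := by
  let g : EuclideanSpace ℝ (Fin (m + m)) → Fin m → ℝ :=
    fun z i => z (Fin.castAdd m i) + z (Fin.natAdd m i)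
  have hg : ContDiff ℝ 1 g := by
    rw [contDiff_pi]; intro i; fun_prop
  refine le_trans ?_ (hg.contDiffOn.dimH_image_le convex_univ (subset_univ _))
  have hsub : univ.pi (fun _ : Fin m => Icc (0 : ℝ) 2) ⊆
      g '' (diagMap (m := m) 0 1 '' boxCantor m) := by
    intro t ht
    have : ∀ i, ∃ p : ℝ × ℝ, p.1 ∈ lineCantor sparseSteps ∧ p.2 ∈ lineCantor denseSteps ∧
        p.1 + p.2 = t i := by
      intro i
      obtain ⟨p, ⟨h1, h2⟩, h3⟩ := nearlySum_add.Icc_subset_image (by fun_prop)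
        (show t i ∈ Icc _ _ by
          have := ht i trivial
          norm_num at this ⊢
          exact this)
      exact ⟨p, h1, h2, h3⟩
    choose p hp1 hp2 hp3 using this
    refine ⟨_, ⟨Fin.addCases (fun i => (p i).1) (fun i => (p i).2), fun i _ => ?_, rfl⟩, ?_⟩
    · refine Fin.addCases (fun i => ?_) (fun i => ?_) i
      · beta_reduce
        rw [coordSteps_castAdd, Fin.addCases_left]; exact hp1 i
      · beta_reduce
        rw [coordSteps_natAdd, Fin.addCases_right]; exact hp2 i
    · funext i
      simp only [g, diagMap_apply, Fin.addCases_left, Fin.addCases_right, Pi.one_apply, one_mul,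
        PiLp.zero_apply, zero_add, hp3]
  refine le_trans ?_ (dimH_mono hsub)
  rw [Real.dimH_of_nonempty_interior]
  · simp
  · rw [interior_pi_set finite_univ]
    exact ⟨fun _ => 1, fun i _ => by
      simp only [interior_Icc]; constructor <;> norm_num⟩

/-! ### Images of small pieces under `φ x`. -/

/-- Near `(a, b)` the partial derivatives of `φ` in the second variable stay within a factor in
`[2/3, 4/3]` of nonzero constants. -/
theorem exists_partials_nearly_const {d : ℕ}
    {φ : EuclideanSpace ℝ (Fin d) → EuclideanSpace ℝ (Fin d) → ℝ}
    {A B : Set (EuclideanSpace ℝ (Fin d))} (hA : IsOpen A) (hB : IsOpen B)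
    (hφ : ContDiffOn ℝ 1
      (fun p : EuclideanSpace ℝ (Fin d) × EuclideanSpace ℝ (Fin d) => φ p.1 p.2) (A ×ˢ B))
    {a b : EuclideanSpace ℝ (Fin d)} (ha : a ∈ A) (hb : b ∈ B)
    (hne : ∀ i : Fin d, lineDeriv ℝ (φ a) b (EuclideanSpace.single i (1 : ℝ)) ≠ 0) :
    ContinuousAt (fun x => φ x b) a ∧ ∃ c : Fin d → ℝ, (∀ i, c i ≠ 0) ∧ ∃ δ > 0,
      ∀ x ∈ Metric.ball a δ, ∀ y ∈ Metric.ball b δ, DifferentiableAt ℝ (φ x) y ∧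
        ∀ i, fderiv ℝ (φ x) y (EuclideanSpace.single i (1 : ℝ)) / c i ∈ Icc (2 / 3 : ℝ) (4 / 3) := by
  set Φ := fun p : EuclideanSpace ℝ (Fin d) × EuclideanSpace ℝ (Fin d) => φ p.1 p.2 with hΦ
  have hopen : IsOpen (A ×ˢ B) := hA.prod hB
  have hdiff : ∀ p ∈ A ×ˢ B, DifferentiableAt ℝ Φ p := fun p hp =>
    (hφ.contDiffAt (hopen.mem_nhds hp)).differentiableAt one_ne_zero
  have hpart : ∀ x ∈ A, ∀ y ∈ B, HasFDerivAt (φ x)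
      ((fderiv ℝ Φ (x, y)).comp (ContinuousLinearMap.inr ℝ _ _)) y := fun x hx y hy =>
    (hdiff (x, y) ⟨hx, hy⟩).hasFDerivAt.comp y (hasFDerivAt_prodMk_right x y)
  have hcont : ContinuousOn (fderiv ℝ Φ) (A ×ˢ B) :=
    hφ.continuousOn_fderiv_of_isOpen hopen le_rfl
  have hab : A ×ˢ B ∈ 𝓝 (a, b) := hopen.mem_nhds ⟨ha, hb⟩
  refine ⟨?_, fun i => fderiv ℝ Φ (a, b) (0, EuclideanSpace.single i 1), fun i => ?_, ?_⟩
  · exact ContinuousAt.comp (f := fun x => (x, b)) (g := Φ) (hdiff (a, b) ⟨ha, hb⟩).continuousAt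
      (by fun_prop)
  · have := hne i
    rwa [(hpart a ha b hb).differentiableAt.lineDeriv_eq_fderiv, (hpart a ha b hb).fderiv] at this
  · have hc : ∀ i, fderiv ℝ Φ (a, b) (0, EuclideanSpace.single i 1) ≠ 0 := fun i => by
      have := hne i
      rwa [(hpart a ha b hb).differentiableAt.lineDeriv_eq_fderiv,
        (hpart a ha b hb).fderiv] at this
    have hev : ∀ᶠ p in 𝓝 (a, b), p ∈ A ×ˢ B ∧ ∀ i, fderiv ℝ Φ p (0, EuclideanSpace.single i 1) /
        fderiv ℝ Φ (a, b) (0, EuclideanSpace.single i 1) ∈ Icc (2 / 3 : ℝ) (4 / 3) := by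
      refine Eventually.and hab (eventually_all.2 fun i => ?_)
      have h1 : ContinuousAt (fun p => fderiv ℝ Φ p (0, EuclideanSpace.single i 1) /
          fderiv ℝ Φ (a, b) (0, EuclideanSpace.single i 1)) (a, b) :=
        ((hcont.continuousAt hab).clm_apply continuousAt_const).div_const _
      refine h1 (Icc_mem_nhds ?_ ?_) <;> (beta_reduce; rw [div_self (hc i)]; norm_num)
    obtain ⟨δ, hδ, hball⟩ := Metric.eventually_nhds_iff_ball.1 hev
    refine ⟨δ, hδ, fun x hx y hy => ?_⟩
    obtain ⟨⟨hxA, hyB⟩, hi⟩ := hball (x, y) (by rw [← ball_prod_same]; exact ⟨hx, hy⟩)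
    refine ⟨(hpart x hxA y hyB).differentiableAt, fun i => ?_⟩
    rw [(hpart x hxA y hyB).fderiv]
    simpa using hi i

theorem exists_scale_diagMap_mem_ball {m : ℕ} (b : EuclideanSpace ℝ (Fin (m + m)))
    (c : Fin (m + m) → ℝ) {ρ : ℝ} (hρ : 0 < ρ) :
    ∃ s > 0, ∀ w ∈ univ.pi fun _ => Icc (0 : ℝ) 1,
      diagMap b (fun i => s / c i) w ∈ Metric.ball b ρ := by
  have hcpt : IsCompact (diagMap 0 (fun i => 1 / c i) ''
      univ.pi fun _ : Fin (m + m) => Icc (0 : ℝ) 1) :=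
    (isCompact_univ_pi fun _ => isCompact_Icc).image (contDiff_diagMap _ _).continuous
  obtain ⟨R, hR0, hR⟩ := hcpt.isBounded.exists_pos_norm_le
  refine ⟨ρ / (2 * R), by positivity, fun w hw => ?_⟩
  have heq : diagMap b (fun i => ρ / (2 * R) / c i) w =
      b + (ρ / (2 * R)) • diagMap 0 (fun i => 1 / c i) w := by
    ext i; simp; ring
  rw [heq, Metric.mem_ball, dist_eq_norm, add_sub_cancel_left, norm_smul,
    Real.norm_of_nonneg (by positivity)]
  calc _ ≤ ρ / (2 * R) * R := by gcongr; exact hR _ ⟨w, hw, rfl⟩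
    _ = ρ / 2 := by field_simp
    _ < ρ := by linarith

theorem boxCantor_subset (m : ℕ) : boxCantor m ⊆ univ.pi fun _ => Icc (0 : ℝ) 1 :=
  pi_mono fun _ _ => lineCantor_subset_Icc

theorem hasDerivAt_diagMap_update {m : ℕ} (b : EuclideanSpace ℝ (Fin (m + m)))
    (k w : Fin (m + m) → ℝ) (i : Fin (m + m)) (u : ℝ) :
    HasDerivAt (fun u => diagMap b k (Function.update w i u))
      (k i • EuclideanSpace.single i (1 : ℝ)) u := by
  have heq : (fun u => diagMap b k (Function.update w i u)) =
      fun u => diagMap b k (Function.update w i 0) + u • (k i • EuclideanSpace.single i (1 : ℝ)) := by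
    funext u
    ext j
    rcases eq_or_ne j i with rfl | hj
    · simp [mul_comm]
    · simp [hj]
  rw [heq]
  simpa using ((hasDerivAt_id u).smul_const (k i • EuclideanSpace.single i (1 : ℝ))).const_add
    (diagMap b k (Function.update w i 0))

theorem increment_bounds_of_deriv {h h' : ℝ → ℝ} {lo hi : ℝ}
    (hd : ∀ u ∈ Icc (0 : ℝ) 1, HasDerivAt h (h' u) u)
    (hb : ∀ u ∈ Icc (0 : ℝ) 1, h' u ∈ Icc lo hi) {u v : ℝ} (hu : u ∈ Icc (0 : ℝ) 1)
    (hv : v ∈ Icc (0 : ℝ) 1) (huv : u ≤ v) :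
    lo * (v - u) ≤ h v - h u ∧ h v - h u ≤ hi * (v - u) := by
  have hc : ContinuousOn h (Icc 0 1) := fun u hu => (hd u hu).continuousAt.continuousWithinAt
  have hdi : DifferentiableOn ℝ h (interior (Icc 0 1)) := fun u hu =>
    (hd u (interior_subset hu)).differentiableAt.differentiableWithinAt
  constructor
  · exact (convex_Icc _ _).mul_sub_le_image_sub_of_le_deriv hc hdi (fun u hu => by
      rw [(hd u (interior_subset hu)).deriv]; exact (hb u (interior_subset hu)).1) u hu v hv huv
  · exact (convex_Icc _ _).image_sub_le_mul_sub_of_deriv_le hc hdi (fun u hu => by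
      rw [(hd u (interior_subset hu)).deriv]; exact (hb u (interior_subset hu)).2) u hu v hv huv

/-- Arbitrarily close to `b` there are pieces whose images under `φ x` contain a common interval,
for all `x` sufficiently close to `a`. -/
theorem exists_piece_image_contains {m : ℕ} (hm : 0 < m)
    {φ : EuclideanSpace ℝ (Fin (m + m)) → EuclideanSpace ℝ (Fin (m + m)) → ℝ}
    {A B : Set (EuclideanSpace ℝ (Fin (m + m)))} (hA : IsOpen A) (hB : IsOpen B)
    (hφ : ContDiffOn ℝ 1 (fun p : EuclideanSpace ℝ (Fin (m + m)) × EuclideanSpace ℝ (Fin (m + m)) =>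
      φ p.1 p.2) (A ×ˢ B))
    {a b : EuclideanSpace ℝ (Fin (m + m))} (ha : a ∈ A) (hb : b ∈ B)
    (hne : ∀ i, lineDeriv ℝ (φ a) b (EuclideanSpace.single i (1 : ℝ)) ≠ 0) {ρ : ℝ} (hρ : 0 < ρ) :
    ∃ K, IsPiece b K ∧ K ⊆ Metric.ball b ρ ∧ ∃ ε > 0, ∃ lo hi : ℝ, lo < hi ∧
      ∀ x ∈ Metric.ball a ε, Ioo lo hi ⊆ φ x '' K := by
  obtain ⟨hcont, c, hc, δ, hδ, hder⟩ := exists_partials_nearly_const hA hB hφ ha hb hne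
  obtain ⟨s, hs, hsball⟩ := exists_scale_diagMap_mem_ball b c (lt_min hρ hδ)
  -- With side `s / c i` in direction `i`, the function `φ x / s` has all partials in `[2/3, 4/3]`
  -- in box coordinates.
  set k : Fin (m + m) → ℝ := fun i => s / c i with hk
  have hk0 : ∀ i, k i ≠ 0 := fun i => div_ne_zero hs.ne' (hc i)
  refine ⟨diagMap b k '' boxCantor m, ⟨k, hk0, rfl⟩, ?_, ?_⟩
  · rintro _ ⟨w, hw, rfl⟩
    exact Metric.ball_subset_ball (min_le_left _ _) (hsball w (boxCantor_subset m hw))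
  have hdiff : ∀ x ∈ Metric.ball a δ, ∀ w ∈ univ.pi fun _ => Icc (0 : ℝ) 1,
      DifferentiableAt ℝ (φ x) (diagMap b k w) ∧
      ∀ i, fderiv ℝ (φ x) (diagMap b k w) (EuclideanSpace.single i (1 : ℝ)) / c i ∈
        Icc (2 / 3 : ℝ) (4 / 3) := fun x hx w hw =>
    hder x hx _ (Metric.ball_subset_ball (min_le_right _ _) (hsball w hw))
  have hupd : ∀ w ∈ univ.pi fun _ => Icc (0 : ℝ) 1, ∀ i, ∀ u ∈ Icc (0 : ℝ) 1,
      Function.update w i u ∈ univ.pi fun _ : Fin (m + m) => Icc (0 : ℝ) 1 := by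
    intro w hw i u hu j _
    rcases eq_or_ne j i with rfl | hj
    · simpa using hu
    · simpa [hj] using hw j trivial
  have hinc : ∀ x ∈ Metric.ball a δ, ∀ w ∈ univ.pi fun _ => Icc (0 : ℝ) 1, ∀ i,
      ∀ u ∈ Icc (0 : ℝ) 1, ∀ v ∈ Icc (0 : ℝ) 1, u ≤ v →
      2 / 3 * (v - u) ≤ φ x (diagMap b k (Function.update w i v)) / s -
        φ x (diagMap b k (Function.update w i u)) / s ∧
      φ x (diagMap b k (Function.update w i v)) / s -
        φ x (diagMap b k (Function.update w i u)) / s ≤ 4 / 3 * (v - u) := by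
    intro x hx w hw i u hu v hv huv
    refine increment_bounds_of_deriv
      (h := fun u => φ x (diagMap b k (Function.update w i u)) / s)
      (h' := fun u => fderiv ℝ (φ x) (diagMap b k (Function.update w i u))
        (EuclideanSpace.single i (1 : ℝ)) / c i) (fun u hu => ?_)
      (fun u hu => (hdiff x hx _ (hupd w hw i u hu)).2 i) hu hv huv
    have h1 := ((hdiff x hx _ (hupd w hw i u hu)).1.hasFDerivAt.comp_hasDerivAt u
      (hasDerivAt_diagMap_update b k w i u)).div_const s
    refine h1.congr_deriv ?_
    rw [map_smul, smul_eq_mul, hk]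
    have := hc i
    field_simp
  let i₀ : Fin (m + m) := Fin.castAdd m ⟨0, hm⟩
  let i₁ : Fin (m + m) := Fin.natAdd m ⟨0, hm⟩
  have hi : i₀ ≠ i₁ := by
    intro h
    have := congrArg Fin.val h
    simp [i₀, i₁] at this
    omega
  -- One sparse and one dense coordinate suffice for an interval; the others are kept at `0`.
  let pt : ℝ → ℝ → Fin (m + m) → ℝ := fun u v =>
    Function.update (Function.update (0 : Fin (m + m) → ℝ) i₀ u) i₁ v
  have hpt : ∀ u v, pt u v = Function.update
      (Function.update (0 : Fin (m + m) → ℝ) i₁ v) i₀ u := fun u v =>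
    Function.update_comm hi u v (0 : Fin (m + m) → ℝ)
  have hzero : (0 : Fin (m + m) → ℝ) ∈ univ.pi fun _ : Fin (m + m) => Icc (0 : ℝ) 1 :=
    fun _ _ => ⟨le_rfl, zero_le_one⟩
  have hsum : ∀ x ∈ Metric.ball a δ, NearlySum fun u v => φ x (diagMap b k (pt u v)) / s := by
    intro x hx
    refine ⟨fun u hu u' hu' v hv h => ?_, fun u hu u' hu' v hv h => ?_,
      fun u hu v hv v' hv' h => ?_, fun u hu v hv v' hv' h => ?_⟩
    · rw [hpt, hpt]; exact (hinc x hx _ (hupd _ hzero i₁ v hv) i₀ u hu u' hu' h).1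
    · rw [hpt, hpt]; exact (hinc x hx _ (hupd _ hzero i₁ v hv) i₀ u hu u' hu' h).2
    · exact (hinc x hx _ (hupd _ hzero i₀ u hu) i₁ v hv v' hv' h).1
    · exact (hinc x hx _ (hupd _ hzero i₀ u hu) i₁ v hv v' hv' h).2
  have hptcont : Continuous fun p : ℝ × ℝ => pt p.1 p.2 :=
    ((continuous_const (y := (0 : Fin (m + m) → ℝ))).update i₀ continuous_fst).update i₁ continuous_snd
  have hfcont : ∀ x ∈ Metric.ball a δ, ContinuousOn
      (fun p : ℝ × ℝ => φ x (diagMap b k (pt p.1 p.2)) / s) (Icc 0 1 ×ˢ Icc 0 1) := by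
    rintro x hx ⟨u, v⟩ ⟨hu, hv⟩
    have h1 := (hdiff x hx _ (hupd _ (hupd _ hzero i₀ u hu) i₁ v hv)).1.continuousAt
    have h2 : ContinuousAt (fun p : ℝ × ℝ => diagMap b k (pt p.1 p.2)) (u, v) :=
      ((contDiff_diagMap b k).continuous.comp hptcont).continuousAt
    exact ((ContinuousAt.comp (f := fun p : ℝ × ℝ => diagMap b k (pt p.1 p.2)) (x := (u, v))
      h1 h2).div_const s).continuousWithinAt
  have hmem : ∀ u ∈ lineCantor sparseSteps, ∀ v ∈ lineCantor denseSteps, pt u v ∈ boxCantor m := by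
    intro u hu v hv j _
    simp only [pt]
    rcases eq_or_ne j i₁ with rfl | h1
    · rw [Function.update_self, coordSteps_natAdd]; exact hv
    rw [Function.update_of_ne h1]
    rcases eq_or_ne j i₀ with rfl | h0
    · rw [Function.update_self, coordSteps_castAdd]; exact hu
    rw [Function.update_of_ne h0]
    exact zero_mem_lineCantor
  have hclose : ∀ᶠ x in 𝓝 a, |φ x b - φ a b| < s / 3 := by
    have := hcont (Metric.ball_mem_nhds _ (show 0 < s / 3 by positivity))
    filter_upwards [this] with x hx using by simpa [Real.dist_eq] using hx
  obtain ⟨ε, hε, hεball⟩ := Metric.eventually_nhds_iff_ball.1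
    (hclose.and (Metric.ball_mem_nhds a hδ))
  -- The image under `φ x` contains `[φ x b, φ x b + 4/3 * s]`, and `φ x b` is within `s / 3` of `φ
  -- a b`, so this interval is common to all such `x`.
  refine ⟨ε, hε, φ a b + s / 3, φ a b + s, by linarith, fun x hx t ht => ?_⟩
  obtain ⟨hxb, hxδ⟩ := hεball x hx
  rw [abs_lt] at hxb
  have h00 : diagMap b k (pt 0 0) = b := by
    have : pt 0 0 = 0 := by simp [pt]
    rw [this, diagMap_zero]
  have unit0 : (0 : ℝ) ∈ Icc (0 : ℝ) 1 := ⟨le_rfl, zero_le_one⟩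
  have unit1 : (1 : ℝ) ∈ Icc (0 : ℝ) 1 := ⟨zero_le_one, le_rfl⟩
  have e1 := (hsum x hxδ).left_lower 0 unit0 1 unit1 0 unit0 zero_le_one
  have e2 := (hsum x hxδ).right_lower 1 unit1 0 unit0 1 unit1 zero_le_one
  rw [h00] at e1
  have hlow : φ x b / s ≤ t / s := by gcongr; linarith [ht.1]
  have hhigh : t / s ≤ φ x b / s + 4 / 3 := by
    rw [div_le_iff₀ hs, add_mul, div_mul_cancel₀ _ hs.ne']
    linarith [ht.2]
  obtain ⟨⟨u, v⟩, ⟨hu, hv⟩, huv⟩ := (hsum x hxδ).Icc_subset_image (hfcont x hxδ)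
    (show t / s ∈ Icc _ _ by
      refine ⟨?_, ?_⟩
      · rw [h00]; exact hlow
      · linarith)
  refine ⟨_, ⟨pt u v, hmem u hu v hv, rfl⟩, ?_⟩
  have : φ x (diagMap b k (pt u v)) / s = t / s := huv
  field_simp at this
  exact this

/-! ### Solving along the tree. -/

/-- Shortest walks to `a` and to `b` extend to shortest walks to `c`, hence to paths; paths in a
tree are unique, so their penultimate vertices agree. -/
theorem SimpleGraph.IsTree.eq_of_adj_of_dist_eq_add_one {V : Type*} {T : SimpleGraph V}
    (hT : T.IsTree) {r a b c : V} (ha : T.Adj a c) (hac : T.dist r c = T.dist r a + 1)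
    (hb : T.Adj b c) (hbc : T.dist r c = T.dist r b + 1) : a = b := by
  obtain ⟨p, hp⟩ := (hT.connected r a).exists_walk_length_eq_dist
  obtain ⟨q, hq⟩ := (hT.connected r b).exists_walk_length_eq_dist
  have hp' : (p.concat ha).IsPath :=
    SimpleGraph.Walk.isPath_of_length_eq_dist _ (by rw [SimpleGraph.Walk.length_concat, hp, hac])
  have hq' : (q.concat hb).IsPath :=
    SimpleGraph.Walk.isPath_of_length_eq_dist _ (by rw [SimpleGraph.Walk.length_concat, hq, hbc])
  have := congrArg SimpleGraph.Walk.penultimate ((hT.existsUnique_path r c).unique hp' hq')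
  simpa using this

/-- If every edge from `τ` to `σ` allows to solve `φ (x τ) (x σ) = l` for `x σ ∈ K σ`, whatever
`x τ ∈ K τ` is, then the equations for all edges can be solved simultaneously. -/
theorem exists_forall_edge_eq {V E : Type*} {T : SimpleGraph V} [Finite V] (hT : T.IsTree) (r : V)
    (φ : E → E → ℝ) (K : V → Set E) (p : V → E) (hp : ∀ σ, p σ ∈ K σ) (l : RootedEdge T r → ℝ)
    (hK : ∀ e : RootedEdge T r, ∀ x ∈ K e.1.1, l e ∈ φ x '' K e.1.2) :
    ∃ x : V → E, (∀ σ, x σ ∈ K σ) ∧ x r = p r ∧ ∀ e : RootedEdge T r, l e = φ (x e.1.1) (x e.1.2) := by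
  have key : ∀ n, ∃ x : V → E, (∀ σ, x σ ∈ K σ) ∧ x r = p r ∧
      ∀ e : RootedEdge T r, T.dist r e.1.2 ≤ n → l e = φ (x e.1.1) (x e.1.2) := by
    intro n
    induction n with
    | zero => exact ⟨p, hp, rfl, fun e he => absurd e.2.2 (by omega)⟩
    | succ n ih =>
      obtain ⟨x, hx, hxr, hxe⟩ := ih
      -- Vertices up to distance `n` stay put, preserving the solved equations. A vertex at distance
      -- `n + 1` has only one parent, so it faces a single equation.
      have : ∀ σ, ∃ y ∈ K σ, (T.dist r σ ≤ n → y = x σ) ∧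
          ∀ e : RootedEdge T r, e.1.2 = σ → T.dist r σ = n + 1 → φ (x e.1.1) y = l e := by
        intro σ
        by_cases h : T.dist r σ = n + 1 ∧ ∃ e : RootedEdge T r, e.1.2 = σ
        · obtain ⟨hn, e, rfl⟩ := h
          obtain ⟨y, hy, hye⟩ := hK e _ (hx e.1.1)
          refine ⟨y, hy, fun h => by omega, fun e' he' _ => ?_⟩
          have : e' = e := by
            refine Subtype.ext (Prod.ext ?_ he')
            exact hT.eq_of_adj_of_dist_eq_add_one e'.2.1 e'.2.2 (he' ▸ e.2.1) (he' ▸ e.2.2)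
          rw [this, hye]
        · exact ⟨x σ, hx σ, fun _ => rfl, fun e he hn => absurd ⟨hn, e, he⟩ h⟩
      choose y hy hyx hye using this
      refine ⟨y, hy, by rw [hyx r (by simp), hxr], fun e he => ?_⟩
      have hd := e.2.2
      rw [hyx e.1.1 (by omega)]
      rcases Nat.lt_or_ge n (T.dist r e.1.2) with h | h
      · exact (hye _ e rfl (by omega)).symm
      · rw [hyx _ h]; exact hxe e h
  obtain ⟨N, hN⟩ := (finite_range fun σ => T.dist r σ).bddAbove
  obtain ⟨x, h1, h2, h3⟩ := key N
  exact ⟨x, h1, h2, fun e => h3 e (hN ⟨_, rfl⟩)⟩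

theorem exists_pos_forall_le {ι : Type*} [Finite ι] (f : ι → ℝ) (hf : ∀ i, 0 < f i) :
    ∃ ε > 0, ∀ i, ε ≤ f i := by
  have h : ∀ᶠ ε : ℝ in 𝓝[>] 0, ∀ i, ε ≤ f i :=
    eventually_all.2 fun i => mem_nhdsWithin_of_mem_nhds (Iic_mem_nhds (hf i))
  obtain ⟨ε, h1, h2⟩ := (h.and self_mem_nhdsWithin).exists
  exact ⟨ε, h2, h1⟩

/-- Positive radii at the vertices, at most `ρ₀`, such that the radius at a parent is bounded by a
given function of the radius at the child. -/
theorem exists_radii {V : Type*} [Finite V] (T : SimpleGraph V) (r : V) {ρ₀ : ℝ} (hρ₀ : 0 < ρ₀)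
    (ε : V → ℝ → ℝ) (hε : ∀ σ ρ, 0 < ρ → 0 < ε σ ρ) :
    ∃ ρ : V → ℝ, (∀ σ, 0 < ρ σ ∧ ρ σ ≤ ρ₀) ∧
      ∀ e : RootedEdge T r, ρ e.1.1 ≤ ε e.1.2 (ρ e.1.2) := by
  have step : ∀ ρ : {ρ : ℝ // 0 < ρ}, ∃ ρ' : {ρ : ℝ // 0 < ρ}, ρ' ≤ ρ ∧ ∀ σ, ρ'.1 ≤ ε σ ρ := by
    intro ρ
    obtain ⟨δ, hδ, h⟩ := exists_pos_forall_le (fun σ => ε σ ρ) fun σ => hε σ ρ ρ.2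
    exact ⟨⟨min δ ρ, lt_min hδ ρ.2⟩, min_le_right δ ρ.1, fun σ => (min_le_left _ _).trans (h σ)⟩
  choose next hle hnext using step
  let S : ℕ → {ρ : ℝ // 0 < ρ} := fun n => next^[n] ⟨ρ₀, hρ₀⟩
  have hS : ∀ n, S (n + 1) = next (S n) := fun n => Function.iterate_succ_apply' _ _ _
  have hanti : Antitone S := antitone_nat_of_succ_le fun n => by rw [hS]; exact hle _
  obtain ⟨N, hN⟩ := (finite_range fun σ => T.dist r σ).bddAbove
  -- The sequence `S` shrinks, so vertices closer to the root get smaller radii; a parent is one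
  -- step further along than its child.
  refine ⟨fun σ => S (N - T.dist r σ), fun σ => ⟨(S _).2, hanti (Nat.zero_le _)⟩, fun e => ?_⟩
  have h1 := e.2.2
  have h2 : T.dist r e.1.2 ≤ N := hN ⟨_, rfl⟩
  have h3 : N - T.dist r e.1.1 = N - T.dist r e.1.2 + 1 := by omega
  beta_reduce
  rw [h3, hS]
  exact hnext _ _

/-! ### Assembling the Cantor set. -/

/-- A set whose coordinate projections are null is totally disconnected. -/
theorem isTotallyDisconnected_of_volume_coord {d : ℕ} {C : Set (EuclideanSpace ℝ (Fin d))}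
    (h : ∀ i, volume ((fun z : EuclideanSpace ℝ (Fin d) => z i) '' C) = 0) :
    IsTotallyDisconnected C := by
  intro t ht hpre x hx y hy
  ext i
  have hc : IsPreconnected ((fun z : EuclideanSpace ℝ (Fin d) => z i) '' t) :=
    hpre.image _ (by fun_prop : Continuous fun z : EuclideanSpace ℝ (Fin d) => z i).continuousOn
  have hsub : uIcc (x i) (y i) ⊆ (fun z : EuclideanSpace ℝ (Fin d) => z i) '' t :=
    hc.ordConnected.uIcc_subset ⟨x, hx, rfl⟩ ⟨y, hy, rfl⟩
  have hnull := measure_mono_null (hsub.trans (image_mono ht)) (h i)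
  rw [Real.volume_interval, ENNReal.ofReal_eq_zero] at hnull
  have := abs_eq_zero.1 (le_antisymm hnull (abs_nonneg _))
  linarith

theorem preperfect_iUnion {X ι : Type*} [TopologicalSpace X] {s : ι → Set X}
    (h : ∀ i, Preperfect (s i)) : Preperfect (⋃ i, s i) := by
  intro x hx
  obtain ⟨i, hi⟩ := mem_iUnion.1 hx
  exact (h i x hi).mono (principal_mono.2 (subset_iUnion s i))

theorem isCantorSet_iUnion_of_isPiece {m : ℕ} (hm : 0 < m) {ι : Type*} [Finite ι] [Nonempty ι]
    {b : ι → EuclideanSpace ℝ (Fin (m + m))} {K : ι → Set (EuclideanSpace ℝ (Fin (m + m)))}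
    (hK : ∀ i, IsPiece (b i) (K i)) : IsCantorSet (⋃ i, K i) := by
  have hcpt : IsCompact (⋃ i, K i) := isCompact_iUnion fun i => (hK i).isCompact
  obtain ⟨i⟩ := ‹Nonempty ι›
  refine ⟨⟨b i, mem_iUnion.2 ⟨i, (hK i).base_mem⟩⟩, hcpt, ?_, hcpt.isClosed,
    preperfect_iUnion fun i => (hK i).preperfect hm⟩
  refine isTotallyDisconnected_of_volume_coord fun j => ?_
  rw [image_iUnion]
  exact measure_iUnion_null fun i => (hK i).volume_coord j

theorem exists_injective_mem_of_isOpen {V E : Type*} [Finite V] [NormedAddCommGroup E]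
    [NormedSpace ℝ E] [Nontrivial E] {U : Set E} (hU : IsOpen U) (hne : U.Nonempty) :
    ∃ p : V → E, Function.Injective p ∧ ∀ σ, p σ ∈ U := by
  obtain ⟨x, hx⟩ := hne
  have hinf : U.Infinite := infinite_of_mem_nhds x (hU.mem_nhds hx)
  have : Infinite U := hinf.to_subtype
  obtain ⟨n, ⟨e⟩⟩ := Finite.exists_equiv_fin V
  let f : V ↪ U := e.toEmbedding.trans (Fin.valEmbedding.trans (Infinite.natEmbedding U))
  exact ⟨fun σ => f σ, Subtype.val_injective.comp f.injective, fun σ => (f σ).2⟩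

theorem corollary2p10 {V : Type*} [Finite V] (T : SimpleGraph V) (hT : T.IsTree) (r : V)
    (d : ℕ) (hd : 0 < d) (hd_even : Even d)
    (φ : EuclideanSpace ℝ (Fin d) → EuclideanSpace ℝ (Fin d) → ℝ)
    (hφ : DerivativeCondition φ) :
    ∃ C : Set (EuclideanSpace ℝ (Fin d)),
      IsCantorSet C ∧ dimH C = (d : ENNReal) / 2 ∧
      ∃ y ∈ C, (interior (pinnedTreeDistanceSet φ T r C y)).Nonempty := by
  obtain ⟨m, rfl⟩ := hd_even
  have hm : 0 < m := by omega
  obtain ⟨U, hUo, hUne, hU⟩ := hφ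
  have : Nonempty (Fin (m + m)) := ⟨⟨0, hd⟩⟩
  obtain ⟨p, hpinj, hpU⟩ := exists_injective_mem_of_isOpen (V := V) hUo hUne
  obtain ⟨ρ₀, hρ₀, hsep⟩ : ∃ ρ₀ > 0, ∀ q : {q : V × V // q.1 ≠ q.2},
      ρ₀ ≤ dist (p q.1.1) (p q.1.2) / 2 :=
    exists_pos_forall_le _ fun q => half_pos (dist_pos.2 (hpinj.ne q.2))
  -- The tolerance `ε` depends only on the child's vertex and radius, which allows choosing radii
  -- from the leaves inwards. Values for `ρ ≤ 0` are arbitrary.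
  have hpiece : ∀ σ : V, ∀ ρ : ℝ, ∃ K : Set (EuclideanSpace ℝ (Fin (m + m))), ∃ ε : ℝ, 0 < ρ →
      IsPiece (p σ) K ∧ K ⊆ Metric.ball (p σ) ρ ∧ 0 < ε ∧
      ∀ e : RootedEdge T r, e.1.2 = σ → ∃ lo hi : ℝ, lo < hi ∧
        ∀ x ∈ Metric.ball (p e.1.1) ε, Ioo lo hi ⊆ φ x '' K := by
    intro σ ρ
    by_cases hρ : 0 < ρ
    swap
    · exact ⟨∅, 0, fun h => absurd h hρ⟩
    by_cases h : ∃ e : RootedEdge T r, e.1.2 = σ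
    · obtain ⟨e, rfl⟩ := h
      obtain ⟨A, B, hA, hB, -, -, ha, hb, hC, hne⟩ :=
        hU _ (hpU e.1.1) _ (hpU e.1.2) (hpinj.ne e.2.1.ne)
      obtain ⟨K, hK, hKρ, ε, hε, lo, hi, hlt, himg⟩ :=
        exists_piece_image_contains hm hA hB hC ha hb (hne _ ha _ hb) hρ
      refine ⟨K, ε, fun _ => ⟨hK, hKρ, hε, fun e' he' => ⟨lo, hi, hlt, ?_⟩⟩⟩
      rwa [hT.eq_of_adj_of_dist_eq_add_one e'.2.1 e'.2.2 (he' ▸ e.2.1) (he' ▸ e.2.2)]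
    · obtain ⟨s, hs, hball⟩ := exists_scale_diagMap_mem_ball (p σ) 1 hρ
      refine ⟨_, 1, fun _ => ⟨⟨fun i => s / (1 : Fin (m + m) → ℝ) i, fun i => by simpa using hs.ne',
        rfl⟩, ?_, one_pos, fun e he => absurd ⟨e, he⟩ h⟩⟩
      rintro _ ⟨w, hw, rfl⟩
      exact hball w (boxCantor_subset m hw)
  choose K ε hKε using hpiece
  obtain ⟨ρ, hρ, hρε⟩ := exists_radii T r hρ₀ ε fun σ ρ h => (hKε σ ρ h).2.2.1
  have hK := fun σ => hKε σ (ρ σ) (hρ σ).1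
  choose lo hi hlt himg using fun e : RootedEdge T r => (hK e.1.2).2.2.2 e rfl
  -- The index `none` adds an unscaled piece at the origin, used only for the lower bound on
  -- dimension.
  let b : Option V → EuclideanSpace ℝ (Fin (m + m)) := fun o => o.elim 0 p
  let L : Option V → Set (EuclideanSpace ℝ (Fin (m + m))) := fun o =>
    o.elim (diagMap 0 1 '' boxCantor m) fun σ => K σ (ρ σ)
  have hL : ∀ o, IsPiece (b o) (L o) := by
    rintro (_ | σ)
    · exact ⟨1, fun i => one_ne_zero, rfl⟩
    · exact (hK σ).1
  have hKL : ∀ σ, K σ (ρ σ) ⊆ ⋃ o, L o := fun σ => subset_iUnion L (some σ)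
  refine ⟨⋃ o, L o, isCantorSet_iUnion_of_isPiece hm hL, ?_, p r, hKL r (hK r).1.base_mem, ?_⟩
  · have hhalf : ((m + m : ℕ) : ℝ≥0∞) / 2 = m := by
      rw [← two_mul, Nat.cast_mul, mul_comm, Nat.cast_ofNat]
      exact ENNReal.mul_div_cancel_right (by norm_num) (by norm_num)
    rw [hhalf]
    refine le_antisymm ?_ ((le_dimH_diagMap_one m).trans (dimH_mono (subset_iUnion L none)))
    rw [dimH_iUnion]
    exact iSup_le fun o => (hL o).dimH_le
  · refine ⟨fun e => (lo e + hi e) / 2, mem_interior.2 ⟨univ.pi fun e => Ioo (lo e) (hi e), ?_,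
      isOpen_set_pi finite_univ fun e _ => isOpen_Ioo, fun e _ => ?_⟩⟩
    · intro l hl
      obtain ⟨x, hx, hxr, hxe⟩ := exists_forall_edge_eq hT r φ (fun σ => K σ (ρ σ)) p
        (fun σ => (hK σ).1.base_mem) l fun e x hx => himg e x
          (Metric.ball_subset_ball (hρε e) ((hK e.1.1).2.1 hx)) (hl e trivial)
      refine ⟨x, fun σ τ hστ => ?_, fun σ => hKL σ (hx σ), hxr, hxe⟩
      -- Points of different pieces are distinct: each lies within `ρ₀` of its centre, and `ρ₀` is
      -- at most half the distance between any two centres.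
      by_contra hne
      have h1 := hsep ⟨(σ, τ), hne⟩
      have h2 := (hK σ).2.1 (hx σ)
      have h3 := (hK τ).2.1 (hx τ)
      rw [Metric.mem_ball] at h2 h3
      rw [← hστ] at h3
      have h4 := dist_triangle_left (p σ) (p τ) (x σ)
      have h5 := (hρ σ).2
      have h6 := (hρ τ).2
      simp only at h1
      linarith
    · constructor <;> linarith [hlt e]
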